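/- Let $p$ be an odd prime, let $m,u$ be positive integers, $q=p^m$, $v=\gcd(m,u)$, and let $\mathrm{Tr}$ be the trace function from $\mathbb{F}_q$ to $\mathbb{F}_p$. Let $$D_2=\{(x,y)\in\mathbb{F}_q^2\setminus\{(0,0)\}:\ \mathrm{Tr}(x^2+y^{p^u+1})=0\},$$ and let $C_{D_2}=\{(\mathrm{Tr}(ax+by))_{(x,y)\in D_2}:\ a,b\in\mathbb{F}_q\}$, a linear code over $\mathbb{F}_p$ of length $|D_2|$. For $w\ge 0$ let $A_w$ be the number of codewords of Hamming weight $w$ in $C_{D_2}$. Suppose that $m/v$ is odd or $m/v\equiv 2\pmod 4$, and exclude the case in which $p\equiv 3\pmod 4$ and $m=1$ (in which $D_2=\varnothing$). Then $C_{D_2}$ is an $[n,2m]$ linear code (it has length $n$ and dimension $2m$ over $\mathbb{F}_p$) and a two-weight code (exactly two of $A_1,\dots,A_n$ are nonzero), where: (a) if $p\equiv 3\pmod 4$ and $v$ is odd, then $n=(p^m+1)(p^{m-1}-1)$, and $A_0=1$, $A_{w_1}=(p^m+1)(p^{m-1}-1)$ for $w_1=(p-1)p^{2m-2}$, $A_{w_2}=(p^m+1)p^{m-1}(p-1)$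 for $w_2=(p-1)p^{2m-2}\left(1-\frac{1}{p^{m-1}}\right)$, and $A_w=0$ for all other $w$; (b) otherwise, $n=(p^m-1)(p^{m-1}+1)$, and $A_0=1$, $A_{w_1}=(p^m-1)(p^{m-1}+1)$ for $w_1=(p-1)p^{2m-2}$, $A_{w_2}=(p^m-1)p^{m-1}(p-1)$ for $w_2=(p-1)p^{2m-2}\left(1+\frac{1}{p^{m-1}}\right)$, and $A_w=0$ for all other $w$. -/

import Mathlib

/-- The number `A_w` of codewords of Hamming weight `w` in a linear code `C ⊆ K^ι`. -/
noncomputable def weightCount {K ι : Type*} [Field K] [DecidableEq K] [Fintype ι]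
    (C : Submodule K (ι → K)) (w : ℕ) : ℕ :=
  {c : ι → K | c ∈ C ∧ hammingNorm c = w}.ncard

/-- `C` is an `[n, k]` linear code: it has length `n` and dimension `k`. -/
def IsLinearCode {K ι : Type*} [Field K] [Fintype ι]
    (C : Submodule K (ι → K)) (n k : ℕ) : Prop :=
  Fintype.card ι = n ∧ Module.finrank K C = k

/-- `C` is a `t`-weight code: exactly `t` of the numbers `A_1, …, A_n` are nonzero,
where `n` is the length of `C`. -/
def IsWeightCode {K ι : Type*} [Field K] [DecidableEq K] [Fintype ι]
    (t : ℕ) (C : Submodule K (ι → K)) : Prop :=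
  ((Finset.Icc 1 (Fintype.card ι)).filter (fun i => weightCount C i ≠ 0)).card = t

/-- The linear map sending `(a, b)` to `c(a, b) = (Tr(a x + b y))_{(x, y) ∈ D}`. -/
noncomputable def codewordMap (p : ℕ) [Fact p.Prime] {F : Type*} [Field F] [Algebra (ZMod p) F]
    (D : Finset (F × F)) : (F × F) →ₗ[ZMod p] (D → ZMod p) where
  toFun ab := fun d => Algebra.trace (ZMod p) F (ab.1 * d.1.1 + ab.2 * d.1.2)
  map_add' s t := by
    funext d
    simp only [Prod.fst_add, Prod.snd_add, Pi.add_apply, ← map_add]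
    congr 1
    ring
  map_smul' r s := by
    funext d
    simp only [Prod.smul_fst, Prod.smul_snd, Pi.smul_apply, RingHom.id_apply, ← map_smul,
      smul_add, smul_mul_assoc]

/-- The code `C_D = {c(a, b) : a, b ∈ F}` with defining set `D`; its coordinates are indexed
by the elements of `D`. -/
noncomputable def definingSetCode (p : ℕ) [Fact p.Prime] {F : Type*} [Field F]
    [Algebra (ZMod p) F] (D : Finset (F × F)) : Submodule (ZMod p) (D → ZMod p) :=
  LinearMap.range (codewordMap p D)

/-- The set `D₂ = {(x, y) ∈ F² \ {(0, 0)} : Tr(x² + y^(p^u + 1)) = 0}`. -/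
noncomputable def definingSetTwo (p u : ℕ) [Fact p.Prime] (F : Type*) [Field F] [Fintype F]
    [DecidableEq F] [Algebra (ZMod p) F] : Finset (F × F) :=
  Finset.univ.filter (fun z =>
    z ≠ (0, 0) ∧ Algebra.trace (ZMod p) F (z.1 ^ 2 + z.2 ^ (p ^ u + 1)) = 0)

/-! ### Exponential sums of quadratic forms -/

section Forms

variable {K V : Type*} [Field K] [AddCommGroup V] [Module K V]

/-! On the `2m`-dimensional `ZMod p`-space `F × F`, `Q(x, y) = Tr(x² + y^(p^u+1))` is a quadratic
form, the diagonal `B z z` of the bilinear form `planeForm`, which need not be symmetric. Its polar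
form `B z w + B w z` is nondegenerate, so the polar functionals of vectors `w` exhaust the dual
space, as do the trace functionals of pairs `(a, b)`. The code may therefore be indexed by `w`, with
the nonzero isotropic vectors as coordinates (`definingSetCode_eq_range_polarCodeword`).

Suppose that `∑ ψ(c Q(z)) = ε p^m` for every `c ≠ 0`, with a sign `ε` independent of `c`.
Orthogonality of characters counts the isotropic vectors, and completing the square counts those
orthogonal to a given `w ≠ 0`. The second count depends only on whether `Q(w) = 0`, so there are two
weights, with frequencies given by the first count (`weightCount_polarCode`).

It remains to find `ε`. The sum factors over `x` and `y`. If `m/v` is odd, the powers `y^(p^u+1)`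
and `y²` have equally large fibres, and the product is the square of a quadratic Gauss sum. If `m/v
≡ 2 (mod 4)`, each factor is an integer with square `p^m`, and congruences decide its sign: modulo
`p^v + 1` for the factor in `y`, modulo `4` for the factor in `x`. In both cases `ε = -1` exactly
when `p ≡ 3 (mod 4)` and `v` is odd. -/

theorem apply_self_add_smul (B : LinearMap.BilinForm K V) (z w : V) (r : K) :
    B (z + r • w) (z + r • w) = B z z + r * (B z w + B w z) + r ^ 2 * B w w := by
  simp only [map_add, map_smul, LinearMap.add_apply, LinearMap.smul_apply, smul_eq_mul]
  ring

variable [Fintype V]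

/-- Completing the square in an exponential sum. -/
theorem sum_addChar_apply_self_add_linear (ψ : AddChar K ℂ) (B : LinearMap.BilinForm K V) (w : V)
    {c : K} (hc : c ≠ 0) (d : K) :
    ∑ z, ψ (c * B z z + d * (B z w + B w z)) =
      ψ (c⁻¹ * (-(d ^ 2 * B w w))) * ∑ z, ψ (c * B z z) := by
  rw [← Equiv.sum_comp (Equiv.addRight ((d / c) • w)) (fun z => ψ (c * B z z)), Finset.mul_sum]
  refine Finset.sum_congr rfl fun z _ => ?_
  rw [← AddChar.map_add_eq_mul, Equiv.coe_addRight, apply_self_add_smul]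
  congr 1
  field_simp
  ring

theorem sum_addChar_comp_linear_eq_zero {ψ : AddChar K ℂ} (hψ : ψ.IsPrimitive) (f : V →ₗ[K] K)
    (hf : f ≠ 0) : ∑ z, ψ (f z) = 0 := by
  obtain ⟨z₀, hz₀⟩ : ∃ z, f z ≠ 0 := by
    by_contra! h
    exact hf (LinearMap.ext h)
  have h1 : ψ ≠ 1 := by
    have := hψ (one_ne_zero)
    rwa [AddChar.mulShift_one] at this
  obtain ⟨a, ha⟩ := AddChar.ne_one_iff.1 h1
  have h2 : ψ.compAddMonoidHom f.toAddMonoidHom ≠ 0 := by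
    refine AddChar.ne_zero_iff.2 ⟨(a / f z₀) • z₀, ?_⟩
    simpa [hz₀] using ha
  exact AddChar.sum_eq_zero_iff_ne_zero.2 h2

variable [Fintype K] [DecidableEq K]

theorem card_isotropic_mul_card {ψ : AddChar K ℂ} (hψ : ψ.IsPrimitive)
    (B : LinearMap.BilinForm K V) {S : ℂ} (hS : ∀ c : K, c ≠ 0 → ∑ z, ψ (c * B z z) = S) :
    ((Finset.univ.filter fun z => B z z = 0).card : ℂ) * Fintype.card K =
      Fintype.card V + (Fintype.card K - 1) * S := by
  have h1 : ∑ z, ∑ c, ψ (c * B z z) =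
      ((Finset.univ.filter fun z => B z z = 0).card : ℂ) * Fintype.card K := by
    simp_rw [AddChar.sum_mulShift _ hψ]
    push_cast
    rw [← Finset.sum_filter, Finset.sum_const, nsmul_eq_mul]
  rw [← h1, Finset.sum_comm, ← Finset.add_sum_erase _ _ (Finset.mem_univ 0),
    Finset.sum_congr rfl fun c hc => hS c (Finset.ne_of_mem_erase hc), Finset.sum_const,
    Finset.card_erase_of_mem (Finset.mem_univ _), nsmul_eq_mul, Finset.card_univ,
    Nat.cast_sub Fintype.card_pos]
  simp

theorem sum_addChar_inv_mul {ψ : AddChar K ℂ} (hψ : ψ.IsPrimitive) (a : K) :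
    ∑ c ∈ Finset.univ.erase 0, ψ (c⁻¹ * a) = (if a = 0 then (Fintype.card K : ℂ) else 0) - 1 := by
  have h1 : ∑ c : K, ψ (c⁻¹ * a) = if a = 0 then (Fintype.card K : ℂ) else 0 := by
    have := AddChar.sum_mulShift a hψ
    rw [← Equiv.sum_comp (Equiv.inv K)] at this
    simpa using this
  rw [← h1, ← Finset.add_sum_erase _ _ (Finset.mem_univ (0 : K))]
  simp

/-- The number of isotropic vectors orthogonal to a given nonzero vector. -/
theorem card_isotropic_orthogonal_mul_card_sq {ψ : AddChar K ℂ} (hψ : ψ.IsPrimitive)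
    (B : LinearMap.BilinForm K V) (hB : ∀ w, (∀ z, B z w + B w z = 0) → w = 0) {S : ℂ}
    (hS : ∀ c : K, c ≠ 0 → ∑ z, ψ (c * B z z) = S) {w : V} (hw : w ≠ 0) :
    ((Finset.univ.filter fun z => B z z = 0 ∧ B z w + B w z = 0).card : ℂ) *
        Fintype.card K ^ 2 =
      Fintype.card V + (if B w w = 0 then (Fintype.card K : ℂ) ^ 2 - Fintype.card K else 0) * S := by
  have h1 : ∑ z, ∑ d, ∑ c, ψ (c * B z z + d * (B z w + B w z)) =
      ((Finset.univ.filter fun z => B z z = 0 ∧ B z w + B w z = 0).card : ℂ) *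
        Fintype.card K ^ 2 := by
    simp_rw [AddChar.map_add_eq_mul, ← Finset.sum_mul, ← Finset.mul_sum,
      AddChar.sum_mulShift _ hψ]
    push_cast
    rw [Finset.card_filter, Nat.cast_sum, Finset.sum_mul]
    refine Finset.sum_congr rfl fun z _ => ?_
    by_cases h : B z z = 0 <;> by_cases h' : B z w + B w z = 0 <;> simp [h, h', sq]
  have h2 : ∀ d : K, d ≠ 0 → ∑ z, ψ (d * (B z w + B w z)) = 0 := by
    intro d hd
    refine sum_addChar_comp_linear_eq_zero hψ (d • (B.flip w + B w)) fun h0 => hw (hB w fun z => ?_)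
    have := LinearMap.congr_fun h0 z
    simpa [hd, ← mul_add] using this
  -- The terms with `c = 0`: only `d = 0` survives.
  have h3 : ∑ d : K, ∑ z, ψ (d * (B z w + B w z)) = Fintype.card V := by
    rw [Finset.sum_eq_single_of_mem 0 (Finset.mem_univ _) fun d _ hd => h2 d hd]
    simp
  have h4 : ∀ d : K, ∑ c, ∑ z, ψ (c * B z z + d * (B z w + B w z)) =
      ∑ z, ψ (d * (B z w + B w z)) +
        ((if d ^ 2 * B w w = 0 then (Fintype.card K : ℂ) else 0) - 1) * S := by
    intro d
    rw [← Finset.add_sum_erase _ _ (Finset.mem_univ (0 : K))]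
    congr 1
    · simp
    · have := sum_addChar_inv_mul hψ (-(d ^ 2 * B w w))
      simp only [neg_eq_zero] at this
      rw [← this, Finset.sum_mul]
      refine Finset.sum_congr rfl fun c hc => ?_
      rw [sum_addChar_apply_self_add_linear ψ B w (Finset.ne_of_mem_erase hc),
        hS c (Finset.ne_of_mem_erase hc)]
  rw [← h1, Finset.sum_comm]
  simp_rw [Finset.sum_comm (s := (Finset.univ : Finset V)), h4]
  rw [Finset.sum_add_distrib, h3, ← Finset.sum_mul, Finset.sum_sub_distrib]
  congr 2
  -- If `B w w ≠ 0`, only `d = 0` contributes `Fintype.card K`, which cancels the sum of the `-1`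
  -- over all `d`, so `S` drops out.
  by_cases h : B w w = 0
  · simp [h, sq]
  · simp [h]

end Forms

/-! ### Weights of the code of a quadratic form -/

section WeightDistribution

theorem weightCount_range {K ι V : Type*} [Field K] [DecidableEq K] [Fintype ι] [AddCommGroup V]
    [Module K V] [Fintype V] {f : V →ₗ[K] (ι → K)} (hf : Function.Injective f) (i : ℕ) :
    weightCount (LinearMap.range f) i =
      (Finset.univ.filter fun v => hammingNorm (f v) = i).card := by
  classical
  have h : {c : ι → K | c ∈ LinearMap.range f ∧ hammingNorm c = i} =
      f '' (Finset.univ.filter fun v => hammingNorm (f v) = i : Finset V) := by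
    ext c
    simp only [LinearMap.mem_range, Set.mem_ofPred_eq, Finset.coe_filter, Finset.mem_univ, true_and,
      Set.mem_image]
    constructor
    · rintro ⟨⟨v, rfl⟩, h⟩
      exact ⟨v, h, rfl⟩
    · rintro ⟨v, h, rfl⟩
      exact ⟨⟨v, rfl⟩, h⟩
  rw [weightCount, h, Set.ncard_image_of_injective _ hf, Set.ncard_coe_finset]

theorem isWeightCode_two {K ι : Type*} [Field K] [DecidableEq K] [Fintype ι]
    {C : Submodule K (ι → K)} {w₁ w₂ : ℕ} (h₁ : w₁ ≠ 0) (h₂ : w₂ ≠ 0) (h₁₂ : w₁ ≠ w₂)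
    (h : ∀ i, i ≠ 0 → (weightCount C i ≠ 0 ↔ i = w₁ ∨ i = w₂)) : IsWeightCode 2 C := by
  have hle : ∀ i, weightCount C i ≠ 0 → i ≤ Fintype.card ι := by
    intro i hi
    obtain ⟨c, -, rfl⟩ := Set.nonempty_of_ncard_ne_zero hi
    exact hammingNorm_le_card_fintype
  have : (Finset.Icc 1 (Fintype.card ι)).filter (fun i => weightCount C i ≠ 0) = {w₁, w₂} := by
    ext i
    simp only [Finset.mem_filter, Finset.mem_Icc, Finset.mem_insert, Finset.mem_singleton]
    constructor
    · rintro ⟨⟨hi, -⟩, hc⟩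
      exact (h i (by omega)).1 hc
    · intro hi
      have h0 : i ≠ 0 := by
        rcases hi with rfl | rfl <;> assumption
      have := (h i h0).2 hi
      exact ⟨⟨by omega, hle i this⟩, this⟩
  rw [IsWeightCode, this, Finset.card_pair h₁₂]

variable {K V : Type*} [Field K] [AddCommGroup V] [Module K V]

/-- The linear map sending `w` to the values of the polar functional of `w` on the points
of `D`. -/
noncomputable def polarCodeword (B : LinearMap.BilinForm K V) (D : Finset V) :
    V →ₗ[K] (D → K) :=
  LinearMap.pi fun d => B d + B.flip d

variable [Fintype V] [DecidableEq V] [DecidableEq K]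

/-- The nonzero isotropic vectors of a bilinear form. -/
def isotropicSet (B : LinearMap.BilinForm K V) : Finset V :=
  Finset.univ.filter fun z => z ≠ 0 ∧ B z z = 0

theorem card_isotropicSet (B : LinearMap.BilinForm K V) :
    ((isotropicSet B).card : ℤ) = (Finset.univ.filter fun z => B z z = 0).card - 1 := by
  have h : isotropicSet B = (Finset.univ.filter fun z => B z z = 0).erase 0 := by
    ext z
    simp [isotropicSet]
  have h0 : (0 : V) ∈ Finset.univ.filter fun z => B z z = 0 := by simp
  rw [h, ← Finset.card_erase_add_one h0]
  simp

/-- The zero vector is not a coordinate, but it lies in both sets counted here and so cancels. -/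
theorem hammingNorm_polarCodeword_add (B : LinearMap.BilinForm K V) (w : V) :
    hammingNorm (polarCodeword B (isotropicSet B) w) +
      (Finset.univ.filter fun z => B z z = 0 ∧ B z w + B w z = 0).card =
      (Finset.univ.filter fun z => B z z = 0).card := by
  have h : hammingNorm (polarCodeword B (isotropicSet B) w) =
      ((Finset.univ.filter fun z => B z z = 0).filter fun z => ¬ (B z w + B w z = 0)).card := by
    rw [hammingNorm, ← Finset.card_map (Function.Embedding.subtype _)]
    congr 1
    ext z
    simp only [Finset.mem_map, Finset.mem_filter, Finset.mem_univ, true_and,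
      Function.Embedding.subtype_apply]
    constructor
    · rintro ⟨⟨x, hx⟩, h1, rfl⟩
      exact ⟨(Finset.mem_filter.1 hx).2.2, h1⟩
    · rintro ⟨h1, h2⟩
      refine ⟨⟨z, Finset.mem_filter.2 ⟨Finset.mem_univ _, ?_, h1⟩⟩, h2, rfl⟩
      rintro rfl
      simp at h2
  rw [h, ← Finset.filter_filter, add_comm, Finset.card_filter_add_card_filter_not]

variable [Fintype K] {ψ : AddChar K ℂ} (hψ : ψ.IsPrimitive) {B : LinearMap.BilinForm K V} {r : ℕ} {ε : ℤ}
  (hV : Fintype.card V = (Fintype.card K * r) ^ 2)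
  (hS : ∀ c : K, c ≠ 0 → ∑ z, ψ (c * B z z) = ε * (Fintype.card K * r))

include hψ hV hS

omit [DecidableEq V] in
theorem card_isotropic :
    ((Finset.univ.filter fun z => B z z = 0).card : ℤ) =
      Fintype.card K * r ^ 2 + (Fintype.card K - 1) * (ε * r) := by
  have h := card_isotropic_mul_card hψ B hS
  rw [hV] at h
  have hk : (Fintype.card K : ℂ) ≠ 0 := by exact_mod_cast Fintype.card_ne_zero
  have : ((Finset.univ.filter fun z => B z z = 0).card : ℂ) =
      Fintype.card K * r ^ 2 + (Fintype.card K - 1) * (ε * r) := by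
    apply mul_right_cancel₀ hk
    rw [h]
    push_cast
    ring
  exact_mod_cast this

theorem hammingNorm_polarCodeword (hB : ∀ w, (∀ z, B z w + B w z = 0) → w = 0) {w : V}
    (hw : w ≠ 0) :
    (hammingNorm (polarCodeword B (isotropicSet B) w) : ℤ) =
      (Fintype.card K - 1) * (r ^ 2 + if B w w = 0 then 0 else ε * r) := by
  have h1 := card_isotropic hψ hV hS
  have h2 := card_isotropic_orthogonal_mul_card_sq hψ B hB hS hw
  rw [hV] at h2
  have h3 := hammingNorm_polarCodeword_add B w
  have hk : (Fintype.card K : ℂ) ≠ 0 := by exact_mod_cast Fintype.card_ne_zero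
  have h4 : ((Finset.univ.filter fun z => B z z = 0 ∧ B z w + B w z = 0).card : ℂ) =
      r ^ 2 + (if B w w = 0 then (Fintype.card K : ℂ) - 1 else 0) * (ε * r) := by
    apply mul_right_cancel₀ (pow_ne_zero 2 hk)
    rw [h2]
    split_ifs <;> push_cast <;> ring
  have h5 : ((Finset.univ.filter fun z => B z z = 0 ∧ B z w + B w z = 0).card : ℤ) =
      r ^ 2 + (if B w w = 0 then (Fintype.card K : ℤ) - 1 else 0) * (ε * r) := by
    split_ifs at h4 ⊢ <;> exact_mod_cast h4
  zify at h3
  rw [h1, h5] at h3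
  split_ifs at h3 ⊢ <;> linear_combination h3

/-- Both candidate weights of a nonzero `w` are positive; for the second this is `r + ε > 0`. -/
theorem polarCodeword_injective (hB : ∀ w, (∀ z, B z w + B w z = 0) → w = 0) (hr : 0 < r)
    (hpos : 0 < (r : ℤ) + ε) :
    Function.Injective (polarCodeword B (isotropicSet B)) := by
  rw [injective_iff_map_eq_zero]
  intro w hw
  by_contra h
  have h1 := hammingNorm_polarCodeword hψ hV hS hB h
  have hk : (1 : ℤ) < Fintype.card K := by exact_mod_cast Fintype.one_lt_card
  rw [hw, hammingNorm_zero] at h1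
  have hr' : (0 : ℤ) < r := by exact_mod_cast hr
  have : (0 : ℤ) < (Fintype.card K - 1) * (r ^ 2 + if B w w = 0 then 0 else ε * r) := by
    apply mul_pos (by linarith)
    split_ifs
    · positivity
    · nlinarith [mul_pos hr' hpos]
  rw [← h1] at this
  simp at this

theorem weightCount_polarCode (hB : ∀ w, (∀ z, B z w + B w z = 0) → w = 0) (hr : 0 < r)
    (hε : ε ≠ 0) (hpos : 0 < (r : ℤ) + ε) (i : ℕ) :
    (weightCount (LinearMap.range (polarCodeword B (isotropicSet B))) i : ℤ) =
      if i = 0 then 1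
      else if (i : ℤ) = (Fintype.card K - 1) * r ^ 2 then
        Fintype.card K * r ^ 2 + (Fintype.card K - 1) * (ε * r) - 1
      else if (i : ℤ) = (Fintype.card K - 1) * (r ^ 2 + ε * r) then
        (Fintype.card K * r) ^ 2 - (Fintype.card K * r ^ 2 + (Fintype.card K - 1) * (ε * r))
      else 0 := by
  have hinj := polarCodeword_injective hψ hV hS hB hr hpos
  have hk : (1 : ℤ) < Fintype.card K := by exact_mod_cast Fintype.one_lt_card
  have hr' : (0 : ℤ) < r := by exact_mod_cast hr
  have hw1 : (0 : ℤ) < (Fintype.card K - 1) * r ^ 2 :=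
    mul_pos (by linarith) (by positivity)
  have hw2 : (0 : ℤ) < (Fintype.card K - 1) * (r ^ 2 + ε * r) :=
    mul_pos (by linarith) (by nlinarith [mul_pos hr' hpos])
  have hw12 : ((Fintype.card K : ℤ) - 1) * r ^ 2 ≠ (Fintype.card K - 1) * (r ^ 2 + ε * r) := by
    intro h
    have := mul_left_cancel₀ (by linarith) h
    simp [hε, hr.ne'] at this
  have hZ := card_isotropic hψ hV hS
  have key : ∀ w, hammingNorm (polarCodeword B (isotropicSet B) w) = i ↔
      (w = 0 ∧ i = 0) ∨ (w ≠ 0 ∧ B w w = 0 ∧ (i : ℤ) = (Fintype.card K - 1) * r ^ 2) ∨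
        (¬ B w w = 0 ∧ (i : ℤ) = (Fintype.card K - 1) * (r ^ 2 + ε * r)) := by
    intro w
    by_cases h0 : w = 0
    · subst h0
      simp [eq_comm]
    · rw [← Int.natCast_inj, hammingNorm_polarCodeword hψ hV hS hB h0]
      by_cases h : B w w = 0 <;> simp [h, h0, eq_comm]
  rw [weightCount_range hinj]
  simp_rw [key]
  split_ifs with h1 h2 h3
  · subst h1
    rw [Nat.cast_zero]
    have : (Finset.univ.filter fun w : V => w = 0) = {0} := by ext; simp
    simp [hw1.ne, hw2.ne, this]
  · rw [← hZ, ← card_isotropicSet]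
    have h3 := hw12
    rw [← h2] at h3
    simp [h1, ← h2, h3, isotropicSet]
  · rw [← hZ]
    have h4 := Finset.card_filter_add_card_filter_not (s := (Finset.univ : Finset V))
      (fun z => B z z = 0)
    rw [Finset.card_univ, hV] at h4
    zify at h4
    rw [← h4, ← h3]
    simp [h1, h2]
  · simp [h1, h2, h3]

theorem isWeightCode_two_polarCode (hB : ∀ w, (∀ z, B z w + B w z = 0) → w = 0) (hr : 0 < r)
    (hε : ε = 1 ∨ ε = -1) (hpos : 0 < (r : ℤ) + ε) :
    IsWeightCode 2 (LinearMap.range (polarCodeword B (isotropicSet B))) := by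
  have hk : (1 : ℤ) < Fintype.card K := by exact_mod_cast Fintype.one_lt_card
  have hr' : (0 : ℤ) < r := by exact_mod_cast hr
  have hε0 : ε ≠ 0 := by rcases hε with rfl | rfl <;> decide
  have hw1 : (0 : ℤ) < (Fintype.card K - 1) * r ^ 2 :=
    mul_pos (by linarith) (by positivity)
  have hw2 : (0 : ℤ) < (Fintype.card K - 1) * (r ^ 2 + ε * r) :=
    mul_pos (by linarith) (by nlinarith [mul_pos hr' hpos])
  have hw12 : ((Fintype.card K : ℤ) - 1) * r ^ 2 ≠ (Fintype.card K - 1) * (r ^ 2 + ε * r) := by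
    intro h
    have := mul_left_cancel₀ (by linarith) h
    simp [hε0, hr.ne'] at this
  have hq : 0 < (Fintype.card K : ℤ) * r - ε := by
    have : (1 : ℤ) < Fintype.card K * r := by nlinarith
    rcases hε with rfl | rfl <;> linarith
  have hA1 : (Fintype.card K * r ^ 2 + (Fintype.card K - 1) * (ε * r) - 1 : ℤ) ≠ 0 := by
    have h := mul_pos hq hpos
    -- The factorization uses `ε² = 1`.
    have : (Fintype.card K * r ^ 2 + (Fintype.card K - 1) * (ε * r) - 1 : ℤ) =
        (Fintype.card K * r - ε) * (r + ε) := by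
      rcases hε with rfl | rfl <;> ring
    rw [this]
    exact h.ne'
  have hA2 : ((Fintype.card K * r) ^ 2 -
      (Fintype.card K * r ^ 2 + (Fintype.card K - 1) * (ε * r)) : ℤ) ≠ 0 := by
    have h : (0 : ℤ) < (Fintype.card K - 1) * (r * (Fintype.card K * r - ε)) :=
      mul_pos (by linarith) (mul_pos hr' hq)
    have : ((Fintype.card K * r) ^ 2 -
        (Fintype.card K * r ^ 2 + (Fintype.card K - 1) * (ε * r)) : ℤ) =
        (Fintype.card K - 1) * (r * (Fintype.card K * r - ε)) := by ring
    rw [this]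
    exact h.ne'
  obtain ⟨w₁, h₁⟩ := Int.eq_ofNat_of_zero_le hw1.le
  obtain ⟨w₂, h₂⟩ := Int.eq_ofNat_of_zero_le hw2.le
  rw [h₁] at hw1 hw12
  rw [h₂] at hw2 hw12
  refine isWeightCode_two (w₁ := w₁) (w₂ := w₂) (by omega) (by omega) (by omega) fun i hi => ?_
  rw [← Int.natCast_ne_zero, weightCount_polarCode hψ hV hS hB hr hε0 hpos, h₁, h₂, if_neg hi]
  simp only [Int.natCast_inj]
  split_ifs with h3 h4
  · simp [h3, hA1]
  · simp [h4, hA2]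
  · simp [h3, h4]

end WeightDistribution

/-! ### Fibres of power maps on a finite field -/

section PowerFibers

variable {F : Type*} [Field F] [Fintype F] [DecidableEq F]

theorem card_filter_pow_eq_pow {y₀ : F} (hy₀ : y₀ ≠ 0) (k : ℕ) :
    (Finset.univ.filter fun y : F => y ^ k = y₀ ^ k).card =
      (Finset.univ.filter fun y : F => y ^ k = 1).card := by
  refine (Finset.card_bij (fun y _ => y₀ * y) ?_ ?_ ?_).symm
  · intro y hy
    have := (Finset.mem_filter.1 hy).2
    simp [mul_pow, this]
  · intro a _ b _ h
    exact mul_left_cancel₀ hy₀ h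
  · intro b hb
    have := (Finset.mem_filter.1 hb).2
    refine ⟨y₀⁻¹ * b, ?_, by field_simp⟩
    simp [mul_pow, this, hy₀]

/-- A nonempty fibre over a nonzero point is a coset of the kernel, and every `k`-th power is an
`l`-th power. This gives `≤` fibrewise; both families of fibres partition the field, so equality
holds throughout. -/
theorem card_filter_pow_eq_of_dvd {k l : ℕ} (hk : 0 < k) (hlk : l ∣ k)
    (h : ∀ y : F, y ^ k = 1 ↔ y ^ l = 1) (a : F) :
    (Finset.univ.filter fun y : F => y ^ k = a).card =
      (Finset.univ.filter fun y : F => y ^ l = a).card := by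
  have hl : 0 < l := Nat.pos_of_dvd_of_pos hlk hk
  have hle : ∀ a : F, (Finset.univ.filter fun y : F => y ^ k = a).card ≤
      (Finset.univ.filter fun y : F => y ^ l = a).card := by
    intro a
    rcases (Finset.univ.filter fun y : F => y ^ k = a).eq_empty_or_nonempty with h0 | ⟨y₀, hy₀⟩
    · simp [h0]
    · obtain rfl := (Finset.mem_filter.1 hy₀).2
      by_cases hy : y₀ = 0
      · subst hy
        simp [hk.ne', hl.ne']
      · obtain ⟨j, rfl⟩ := hlk
        rw [card_filter_pow_eq_pow hy]
        simp_rw [h]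
        rw [mul_comm, pow_mul, card_filter_pow_eq_pow (pow_ne_zero _ hy)]
  have hsum : ∑ a : F, (Finset.univ.filter fun y : F => y ^ k = a).card =
      ∑ a : F, (Finset.univ.filter fun y : F => y ^ l = a).card := by
    rw [← Finset.card_eq_sum_card_fiberwise fun _ _ => Finset.mem_coe.2 (Finset.mem_univ _),
      ← Finset.card_eq_sum_card_fiberwise fun _ _ => Finset.mem_coe.2 (Finset.mem_univ _)]
  exact (Finset.sum_eq_sum_iff_of_le fun a _ => hle a).1 hsum a (Finset.mem_univ a)

theorem sum_comp_pow (k : ℕ) (f : F → ℂ) :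
    ∑ y, f (y ^ k) = ∑ a, (Finset.univ.filter fun y : F => y ^ k = a).card * f a := by
  rw [← Finset.sum_fiberwise' Finset.univ (fun y : F => y ^ k) f]
  simp

/-- The set is a union of fibres over nonzero points, each a coset of the kernel of the power map.
-/
theorem dvd_card_filter_comp_pow (k N : ℕ)
    (hN : N ∣ (Finset.univ.filter fun y : F => y ^ k = 1).card) (P : F → Prop) [DecidablePred P]
    (hP : ¬ P 0) : N ∣ (Finset.univ.filter fun y : F => P (y ^ k)).card := by
  rcases Nat.eq_zero_or_pos k with rfl | hk
  · simp only [pow_zero] at hN ⊢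
    by_cases h : P 1
    · simpa [h] using hN
    · simp [h]
  rw [Finset.card_eq_sum_card_fiberwise (f := fun y : F => y ^ k) (t := Finset.univ)
    fun _ _ => Finset.mem_coe.2 (Finset.mem_univ _)]
  refine Finset.dvd_sum fun a _ => ?_
  rw [Finset.filter_filter]
  rcases (Finset.univ.filter fun y : F => P (y ^ k) ∧ y ^ k = a).eq_empty_or_nonempty with
    h0 | ⟨y₀, hy₀⟩
  · simp [h0]
  · obtain ⟨h1, rfl⟩ := (Finset.mem_filter.1 hy₀).2
    have hy : y₀ ≠ 0 := by
      rintro rfl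
      exact hP (by rwa [zero_pow hk.ne'] at h1)
    have : (Finset.univ.filter fun y : F => P (y ^ k) ∧ y ^ k = y₀ ^ k) =
        Finset.univ.filter fun y : F => y ^ k = y₀ ^ k :=
      Finset.filter_congr fun y _ => ⟨fun h => h.2, fun h => ⟨h ▸ h1, h⟩⟩
    rw [this, card_filter_pow_eq_pow hy]
    exact hN

/-- The cyclic group of units has an element of order `d`; it lies in the kernel of the `k`-th
power, and Lagrange applies. -/
theorem dvd_card_filter_pow_eq_one {d k : ℕ} (hk : 0 < k) (hd : d ∣ Fintype.card F - 1)
    (h : ∀ y : F, y ^ d = 1 → y ^ k = 1) :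
    d ∣ (Finset.univ.filter fun y : F => y ^ k = 1).card := by
  obtain ⟨e, he⟩ := hd
  obtain ⟨g, hg⟩ := IsCyclic.exists_ofOrder_eq_natCard (α := Fˣ)
  rw [Nat.card_eq_fintype_card, Fintype.card_units, he] at hg
  have hpos : 0 < d * e := hg ▸ orderOf_pos g
  have he0 : e ≠ 0 := by rintro rfl; simp at hpos
  have hord : orderOf (g ^ e) = d := by
    rw [orderOf_pow_of_dvd he0 (hg ▸ Dvd.intro_left d rfl), hg,
      Nat.mul_div_cancel _ (Nat.pos_of_ne_zero he0)]
  have hone : ((g ^ e : Fˣ) : F) ^ d = 1 := by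
    have := pow_orderOf_eq_one (g ^ e)
    rw [hord] at this
    rw [← Units.val_pow_eq_pow_val, this, Units.val_one]
  let H : Subgroup Fˣ := (powMonoidHom k : Fˣ →* Fˣ).ker
  have hH : ∀ u : Fˣ, u ∈ H ↔ (u : F) ^ k = 1 := by
    intro u
    rw [MonoidHom.mem_ker, powMonoidHom_apply, Units.ext_iff, Units.val_pow_eq_pow_val,
      Units.val_one]
  have hdvd : d ∣ Nat.card H := by
    have := Subgroup.orderOf_dvd_natCard H ((hH _).2 (h _ hone))
    rwa [hord] at this
  have e : H ≃ {y : F // y ^ k = 1} :=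
    { toFun := fun u => ⟨u.1, (hH _).1 u.2⟩
      invFun := fun y => ⟨Units.mk0 y.1 fun h0 => by simpa [h0, hk.ne'] using y.2, (hH _).2 y.2⟩
      left_inv := fun u => by ext; rfl
      right_inv := fun y => rfl }
  rwa [Nat.card_congr e, Nat.card_eq_fintype_card, Fintype.card_subtype] at hdvd

/-- An element of the prime field is a `d`-th power as soon as `d * (p - 1)` divides `q - 1`. -/
theorem exists_pow_eq_algebraMap {p : ℕ} [Fact p.Prime] [Algebra (ZMod p) F] {d : ℕ}
    (hd : d * (p - 1) ∣ Fintype.card F - 1) {t : ZMod p} (ht : t ≠ 0) :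
    ∃ y : F, y ^ d = algebraMap (ZMod p) F t := by
  obtain ⟨g, hg⟩ := IsCyclic.exists_ofOrder_eq_natCard (α := Fˣ)
  have hgen := mem_powers_iff_mem_zpowers.2
    ((Subgroup.eq_top_of_card_eq (Subgroup.zpowers g) (by rw [Nat.card_zpowers, hg])) ▸
      Subgroup.mem_top (Units.map (algebraMap (ZMod p) F).toMonoidHom (Units.mk0 t ht)))
  obtain ⟨j, hj⟩ := hgen
  have hj' : (g : F) ^ j = algebraMap (ZMod p) F t := by
    simpa using congrArg Units.val hj
  rw [Nat.card_eq_fintype_card, Fintype.card_units] at hg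
  have h1 : g ^ (j * (p - 1)) = 1 := by
    rw [Units.ext_iff]
    push_cast
    rw [pow_mul, hj', ← map_pow, ZMod.pow_card_sub_one_eq_one ht, map_one]
  -- With `t = g ^ j`, Fermat's `t ^ (p - 1) = 1` makes the order of `g` divide `j * (p - 1)`,
  -- whence `d ∣ j`.
  have h2 : d * (p - 1) ∣ j * (p - 1) := hd.trans (hg ▸ orderOf_dvd_of_pow_eq_one h1)
  have hp : 0 < p - 1 := Nat.sub_pos_of_lt (Fact.out : p.Prime).one_lt
  obtain ⟨i, rfl⟩ := Nat.dvd_of_mul_dvd_mul_right hp h2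
  exact ⟨(g : F) ^ i, by rw [← hj', ← pow_mul, mul_comm]⟩

end PowerFibers

/-! ### The trace to the prime field -/

section Trace

variable {p : ℕ} [Fact p.Prime] {F : Type*} [Field F] [Fintype F] [Algebra (ZMod p) F]

theorem trace_pow_prime_pow (x : F) (k : ℕ) :
    Algebra.trace (ZMod p) F (x ^ p ^ k) = Algebra.trace (ZMod p) F x := by
  induction k with
  | zero => simp
  | succ k ih =>
    rw [pow_succ, pow_mul, ← ih]
    have := Algebra.trace_eq_of_algEquiv
      (FiniteField.frobeniusAlgEquivOfAlgebraic (ZMod p) F) (x ^ p ^ k)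
    simpa [ZMod.card] using this

theorem eq_zero_of_trace_mul_eq_zero {x : F}
    (h : ∀ y, Algebra.trace (ZMod p) F (x * y) = 0) : x = 0 :=
  (traceForm_nondegenerate (ZMod p) F).1 x h

theorem exists_trace_eq (t : ZMod p) : ∃ x : F, Algebra.trace (ZMod p) F x = t :=
  Algebra.trace_surjective (ZMod p) F t

end Trace

/-! ### Modulus and rationality of exponential sums -/

section Sums

variable {K : Type*} [Field K] {ψ : AddChar K ℂ} (hψ : ψ.IsPrimitive)

include hψ

/-- Substituting `z = w + t` in the first factor cancels `B w w` and leaves a linear sum in `w`,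
which vanishes unless `t = 0`. -/
theorem sum_addChar_mul_sum_addChar_neg {V : Type*} [AddCommGroup V] [Module K V] [Fintype V]
    {B : LinearMap.BilinForm K V} (hB : ∀ w, (∀ z, B z w + B w z = 0) → w = 0) {c : K}
    (hc : c ≠ 0) :
    (∑ z, ψ (c * B z z)) * ∑ z, ψ (-c * B z z) = Fintype.card V := by
  have h1 : ∀ t : V, t ≠ 0 → ∑ w, ψ (c * (B w t + B t w)) = 0 := by
    intro t ht
    refine sum_addChar_comp_linear_eq_zero hψ (c • (B.flip t + B t)) fun h0 => ht (hB t fun z => ?_)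
    have := LinearMap.congr_fun h0 z
    simpa [hc, ← mul_add] using this
  have h2 : (∑ z, ψ (c * B z z)) * ∑ z, ψ (-c * B z z) =
      ∑ t, ψ (c * B t t) * ∑ w, ψ (c * (B w t + B t w)) := by
    rw [Finset.sum_mul_sum, Finset.sum_comm]
    simp_rw [Finset.mul_sum]
    rw [Finset.sum_comm (s := (Finset.univ : Finset V)) (t := (Finset.univ : Finset V))
      (f := fun t w => ψ (c * B t t) * ψ (c * (B w t + B t w)))]
    refine Finset.sum_congr rfl fun w _ => ?_
    rw [← Equiv.sum_comp (Equiv.addLeft w)]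
    refine Finset.sum_congr rfl fun t _ => ?_
    rw [← AddChar.map_add_eq_mul, ← AddChar.map_add_eq_mul]
    congr 1
    simp only [Equiv.coe_addLeft, map_add, LinearMap.add_apply]
    ring
  rw [h2, Finset.sum_eq_single_of_mem 0 (Finset.mem_univ _) fun t _ ht => by rw [h1 t ht, mul_zero]]
  simp

/-- Equal fibres over nonzero values make the sum an integer independent of `c`. -/
theorem sum_addChar_of_card_fiber [Fintype K] [DecidableEq K] {α : Type*} [Fintype α] {T : α → K}
    {R : ℕ} (hR : ∀ t, t ≠ 0 → (Finset.univ.filter fun z => T z = t).card = R) {c : K}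
    (hc : c ≠ 0) : ∑ z, ψ (c * T z) = Fintype.card α - Fintype.card K * R := by
  have hone : ∑ t, ψ (t * c) = 0 := by simp [AddChar.sum_mulShift c hψ, hc]
  have hcard : Fintype.card α = ∑ t, (Finset.univ.filter fun z => T z = t).card := by
    rw [← Finset.card_univ, ← Finset.card_eq_sum_card_fiberwise]
    exact fun _ _ => Finset.mem_coe.2 (Finset.mem_univ _)
  rw [← Finset.sum_fiberwise' Finset.univ T fun t => ψ (c * t)]
  simp only [Finset.sum_const, nsmul_eq_mul]
  obtain ⟨r, h⟩ : ∃ r : ℂ, ∀ t : K, ((Finset.univ.filter fun z => T z = t).card : ℂ) =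
      R + if t = 0 then r else 0 := by
    refine ⟨((Finset.univ.filter fun z => T z = 0).card : ℂ) - R, fun t => ?_⟩
    split_ifs with h
    · simp [h]
    · simp [hR t h]
  have hcard' : (Fintype.card α : ℂ) = ∑ t, ((Finset.univ.filter fun z => T z = t).card : ℂ) := by
    exact_mod_cast hcard
  rw [hcard']
  simp_rw [h, add_mul]
  rw [Finset.sum_add_distrib, Finset.sum_add_distrib, ← Finset.mul_sum]
  simp_rw [mul_comm c]
  rw [hone]
  simp

end Sums

/-! ### Iterated Frobenius -/

section PrimePower

theorem pow_prime_pow_odd_mul_eq_inv {p : ℕ} {F : Type*} [Field F] {y : F} {k : ℕ} (hy : y ^ p ^ k = y⁻¹) {n : ℕ} (hn : Odd n) :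
    y ^ p ^ (k * n) = y⁻¹ := by
  obtain ⟨j, rfl⟩ := hn
  induction j with
  | zero => simpa using hy
  | succ j ih =>
    have : k * (2 * (j + 1) + 1) = k * (2 * j + 1) + k + k := by ring
    rw [this, pow_add, pow_mul, pow_add, pow_mul, ih, inv_pow, hy, inv_inv, hy]

variable {p : ℕ} {F : Type*} [Field F] [Fintype F] {m : ℕ} (hF : Fintype.card F = p ^ m)

include hF

theorem pow_prime_pow_eq_self {k : ℕ} (hk : m ∣ k) (y : F) : y ^ p ^ k = y := by
  obtain ⟨j, rfl⟩ := hk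
  rw [pow_mul, ← hF, FiniteField.pow_card_pow]

theorem exponent_pos : 0 < m := by
  rcases Nat.eq_zero_or_pos m with rfl | h
  · have := Fintype.one_lt_card (α := F)
    simp [hF] at this
  · exact h

end PrimePower

/-! ### The form `Tr (y * y' ^ (p ^ u))` -/

section TwistedTraceForm

variable (p : ℕ) [Fact p.Prime] (F : Type*) [Field F] [Algebra (ZMod p) F]

/-- The bilinear form `(y, y') ↦ Tr (y * y' ^ (p ^ u))`. -/
noncomputable def twistedTraceForm (u : ℕ) : LinearMap.BilinForm (ZMod p) F :=
  haveI : CharP F p := (Algebra.charP_iff (ZMod p) F p).1 inferInstance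
  LinearMap.mk₂ (ZMod p) (fun y y' => Algebra.trace (ZMod p) F (y * y' ^ p ^ u))
    (fun a b c => by rw [add_mul, map_add])
    (fun r a b => by rw [smul_mul_assoc, map_smul])
    (fun a b c => by rw [add_pow_char_pow, mul_add, map_add])
    (fun r a b => by rw [smul_pow, ZMod.pow_card_pow, mul_smul_comm, map_smul])

variable {p F}

theorem twistedTraceForm_apply (u : ℕ) (y y' : F) :
    twistedTraceForm p F u y y' = Algebra.trace (ZMod p) F (y * y' ^ p ^ u) := rfl

theorem twistedTraceForm_self (u : ℕ) (y : F) :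
    twistedTraceForm p F u y y = Algebra.trace (ZMod p) F (y ^ (p ^ u + 1)) := by
  rw [twistedTraceForm_apply, pow_succ']

theorem two_ne_zero_of_algebra (hp : p ≠ 2) : (2 : F) ≠ 0 := by
  have : CharP F p := (Algebra.charP_iff (ZMod p) F p).1 inferInstance
  exact Ring.two_ne_zero (by rwa [ringChar.eq F p])

variable [Fintype F] {m : ℕ} (hF : Fintype.card F = p ^ m) (hp : p ≠ 2)

include hF hp

/-- A vector of the radical satisfies `y ^ p ^ (2 * u) = -y`. Iterating `n` times, with `n` odd and
`m ∣ 2 * u * n`, gives `y = -y`. -/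
theorem twistedTraceForm_nondegenerate {u n : ℕ} (hn : Odd n) (hm : m ∣ 2 * u * n) (y : F)
    (h : ∀ z, twistedTraceForm p F u z y + twistedTraceForm p F u y z = 0) : y = 0 := by
  have h1 : y ^ p ^ (2 * u) + y = 0 := by
    -- Frobenius invariance of the trace moves the twist onto `y`; each test vector is written as a
    -- `p ^ u`-th power.
    apply eq_zero_of_trace_mul_eq_zero (p := p)
    intro x
    obtain ⟨z, rfl⟩ : ∃ z, z ^ p ^ u = x :=
      ⟨x ^ p ^ (u * (m - 1)), by
        rw [← pow_mul, ← pow_add]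
        refine pow_prime_pow_eq_self hF ⟨u, ?_⟩ x
        obtain ⟨k, rfl⟩ := Nat.exists_eq_succ_of_ne_zero (exponent_pos hF).ne'
        simp
        ring⟩
    rw [← h z, twistedTraceForm_apply, twistedTraceForm_apply, ← trace_pow_prime_pow (z * _) u,
      ← map_add]
    congr 1
    rw [mul_pow, ← pow_mul, ← pow_add, ← two_mul]
    ring
  have h2 : ∀ j : ℕ, y ^ p ^ (2 * u * j) = (-1) ^ j * y := by
    intro j
    induction j with
    | zero => simp
    | succ j ih =>
      have hodd : Odd (p ^ (2 * u * j)) := ((Fact.out : p.Prime).odd_of_ne_two hp).pow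
      rw [mul_add, mul_one, add_comm, pow_add, pow_mul, eq_neg_of_add_eq_zero_left h1,
        hodd.neg_pow, ih, pow_succ]
      ring
  have h3 := h2 n
  rw [pow_prime_pow_eq_self hF hm, hn.neg_one_pow] at h3
  have h4 : 2 * y = 0 := by linear_combination h3
  exact (mul_eq_zero.1 h4).resolve_left (two_ne_zero_of_algebra hp)

end TwistedTraceForm

/-! ### Odd quotient: reduction to quadratic Gauss sums -/

section OddQuotient

variable {p : ℕ} [Fact p.Prime] {F : Type*} [Field F] [Fintype F] [DecidableEq F]
  [Algebra (ZMod p) F] {m : ℕ} (hF : Fintype.card F = p ^ m) (hp : p ≠ 2)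
  {ψ : AddChar (ZMod p) ℂ} (hψ : ψ.IsPrimitive)

omit [Algebra (ZMod p) F] in
include hp in
-- If `y ^ (p ^ u + 1) = 1`, then `y ^ p ^ u = y⁻¹`; an odd number of iterations returns to `y`, so
-- `y = y⁻¹`. Hence both power maps have kernel `{1, -1}`.
theorem sum_addChar_pow_succ_eq_sum_sq (hF : Fintype.card F = p ^ m) {u n : ℕ} (hn : Odd n)
    (hm : m ∣ u * n) (f : F → ℂ) : ∑ y, f (y ^ (p ^ u + 1)) = ∑ y, f (y ^ 2) := by
  have hdvd : 2 ∣ p ^ u + 1 :=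
    (((Fact.out : p.Prime).odd_of_ne_two hp).pow.add_one).two_dvd
  have hker : ∀ y : F, y ^ (p ^ u + 1) = 1 ↔ y ^ 2 = 1 := by
    intro y
    constructor
    · intro h
      rw [pow_succ] at h
      have h1 := pow_prime_pow_odd_mul_eq_inv (eq_inv_of_mul_eq_one_left h) hn
      rw [pow_prime_pow_eq_self hF hm] at h1
      have h0 : y ≠ 0 := by
        rintro rfl
        simp at h
      field_simp at h1
      exact h1
    · intro h
      obtain ⟨j, hj⟩ := hdvd
      rw [hj, pow_mul, h, one_pow]
  rw [sum_comp_pow, sum_comp_pow]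
  simp_rw [card_filter_pow_eq_of_dvd (Nat.succ_pos _) hdvd hker]

include hF hp hψ in
-- Since `a` has `χ a + 1` square roots, the sum is a Gauss sum. Only its square is independent of
-- `c` in general.
theorem sum_addChar_trace_sq_sq {c : ZMod p} (hc : c ≠ 0) :
    (∑ x : F, ψ (c * Algebra.trace (ZMod p) F (x ^ 2))) ^ 2 =
      ((ZMod.χ₄ (p ^ m : ℕ) : ℤ) : ℂ) * (p ^ m : ℕ) := by
  have : CharP F p := (Algebra.charP_iff (ZMod p) F p).1 inferInstance
  have hchar : ringChar F ≠ 2 := by rwa [ringChar.eq F p]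
  let Ψ : AddChar F ℂ :=
    (AddChar.mulShift ψ c).compAddMonoidHom (Algebra.trace (ZMod p) F).toAddMonoidHom
  have hΨ : ∀ x, Ψ x = ψ (c * Algebra.trace (ZMod p) F x) := fun x => rfl
  have hΨ1 : Ψ ≠ 1 := by
    obtain ⟨a, ha⟩ := AddChar.ne_one_iff.1 (hψ hc)
    obtain ⟨x, hx⟩ := exists_trace_eq (F := F) a
    refine AddChar.ne_one_iff.2 ⟨x, ?_⟩
    rwa [hΨ, hx]
  let χ : MulChar F ℂ := (quadraticChar F).ringHomComp (Int.castRingHom ℂ)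
  have hχ : ∀ a, χ a = (quadraticChar F a : ℂ) := fun a => rfl
  have hgs := gaussSum_sq (χ := χ) (ψ := Ψ)
    ((MulChar.ringHomComp_ne_one_iff (Int.castRingHom ℂ).injective_int).2
      (quadraticChar_ne_one hchar)) ((quadraticChar_isQuadratic F).comp _)
    (AddChar.IsPrimitive.of_ne_one hΨ1)
  rw [hχ, quadraticChar_neg_one hchar, hF] at hgs
  rw [← hgs]
  congr 1
  have h1 : ∀ a : F, ((Finset.univ.filter fun x : F => x ^ 2 = a).card : ℂ) = χ a + 1 := by
    intro a
    have := quadraticChar_card_sqrts hchar a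
    rw [Set.toFinset_ofPred] at this
    rw [hχ]
    exact_mod_cast this
  calc ∑ x : F, ψ (c * Algebra.trace (ZMod p) F (x ^ 2)) = ∑ x : F, Ψ (x ^ 2) := rfl
    _ = gaussSum χ Ψ := by
      rw [sum_comp_pow 2 Ψ]
      simp_rw [h1, add_mul, one_mul]
      rw [Finset.sum_add_distrib, AddChar.sum_eq_zero_of_ne_one hΨ1, add_zero, gaussSum]

end OddQuotient

/-! ### Quotient 2 mod 4: signs from congruences -/

section EvenQuotient

theorem card_modEq_card_fixed_of_involutive_on {α : Type*} [DecidableEq α] (s : Finset α)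
    (g : α → α) (hg : ∀ a ∈ s, g a ∈ s) (hgg : ∀ a ∈ s, g (g a) = a) :
    s.card ≡ (s.filter fun a => g a = a).card [MOD 2] := by
  rw [← Finset.card_filter_add_card_filter_not (s := s) (fun a => g a = a)]
  have h : (s.filter fun a => ¬ g a = a).card ≡ 0 [MOD 2] := by
    rw [← ZMod.natCast_eq_natCast_iff, Finset.cast_card, Nat.cast_zero]
    refine Finset.sum_involution (fun a _ => g a) (fun a _ => by decide)
      (fun a ha _ => (Finset.mem_filter.1 ha).2) (fun a ha => ?_)
      (fun a ha => hgg a (Finset.mem_filter.1 ha).1)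
    obtain ⟨h1, h2⟩ := Finset.mem_filter.1 ha
    refine Finset.mem_filter.2 ⟨hg a h1, fun h => h2 ?_⟩
    rw [hgg a h1] at h
    exact h.symm
  simpa only [add_zero] using h.add_left (s.filter fun a => g a = a).card

variable {p : ℕ} [Fact p.Prime] {F : Type*} [Field F] [Fintype F] [DecidableEq F]
  [Algebra (ZMod p) F]

omit [DecidableEq F] in
-- Multiplication by a `k`-th root of a nonzero prime-field element rescales the trace, mapping one
-- fibre injectively into another.
theorem card_trace_pow_eq_const {k : ℕ}
    (hk : ∀ t : ZMod p, t ≠ 0 → ∃ y : F, y ^ k = algebraMap (ZMod p) F t) {t : ZMod p}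
    (ht : t ≠ 0) :
    (Finset.univ.filter fun y : F => Algebra.trace (ZMod p) F (y ^ k) = t).card =
      (Finset.univ.filter fun y : F => Algebra.trace (ZMod p) F (y ^ k) = 1).card := by
  have key : ∀ a b y, y ^ k = algebraMap (ZMod p) F a →
      ∀ x : F, Algebra.trace (ZMod p) F (x ^ k) = b →
        Algebra.trace (ZMod p) F ((y * x) ^ k) = a * b := by
    intro a b y hy x hx
    rw [mul_pow, hy, ← Algebra.smul_def, map_smul, hx, smul_eq_mul]
  have hle : ∀ a b : ZMod p, a ≠ 0 →
      (Finset.univ.filter fun y : F => Algebra.trace (ZMod p) F (y ^ k) = b).card ≤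
      (Finset.univ.filter fun y : F => Algebra.trace (ZMod p) F (y ^ k) = a * b).card := by
    intro a b ha
    obtain ⟨y, hy⟩ := hk a ha
    rcases Nat.eq_zero_or_pos k with rfl | hk0
    · have : a = 1 := by
        rw [pow_zero] at hy
        exact (algebraMap (ZMod p) F).injective (by rw [← hy, map_one])
      simp [this]
    have hy0 : y ≠ 0 := by
      rintro rfl
      rw [zero_pow hk0.ne'] at hy
      exact ha ((algebraMap (ZMod p) F).injective (by rw [← hy, map_zero]))
    refine Finset.card_le_card_of_injOn (fun x => y * x) (fun x hx => ?_)
      (fun _ _ _ _ h => mul_left_cancel₀ hy0 h)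
    simp only [Finset.coe_filter, Finset.mem_univ, true_and, Set.mem_ofPred_eq] at hx ⊢
    exact key a b y hy x hx
  refine le_antisymm ?_ ?_
  · have := hle t⁻¹ t (inv_ne_zero ht)
    rwa [inv_mul_cancel₀ ht] at this
  · have := hle t 1 ht
    rwa [mul_one] at this

variable {m : ℕ} (hF : Fintype.card F = p ^ m) (hp : p ≠ 2)
  {ψ : AddChar (ZMod p) ℂ} (hψ : ψ.IsPrimitive)

omit [DecidableEq F] in
include hF in
theorem sum_addChar_twistedTraceForm {u : ℕ} (hψ : ψ.IsPrimitive)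
    (hk : ∀ t : ZMod p, t ≠ 0 → ∃ y : F, y ^ (p ^ u + 1) = algebraMap (ZMod p) F t)
    {c : ZMod p} (hc : c ≠ 0) :
    ∑ y : F, ψ (c * twistedTraceForm p F u y y) =
      (((p ^ m : ℕ) - p * (Finset.univ.filter fun y : F =>
        Algebra.trace (ZMod p) F (y ^ (p ^ u + 1)) = 1).card : ℤ) : ℂ) := by
  have := sum_addChar_of_card_fiber hψ
    (T := fun y : F => Algebra.trace (ZMod p) F (y ^ (p ^ u + 1)))
    (fun t ht => card_trace_pow_eq_const hk ht) hc
  simp_rw [twistedTraceForm_self]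
  rw [this, hF, ZMod.card]
  push_cast
  ring

omit [DecidableEq F] in
include hF hp hψ in
theorem sq_sub_card_trace_eq {u n : ℕ} (hn : Odd n) (hm : m ∣ 2 * u * n)
    (hk : ∀ t : ZMod p, t ≠ 0 → ∃ y : F, y ^ (p ^ u + 1) = algebraMap (ZMod p) F t) :
    ((p ^ m : ℕ) - p * (Finset.univ.filter fun y : F =>
        Algebra.trace (ZMod p) F (y ^ (p ^ u + 1)) = 1).card : ℤ) ^ 2 = (p ^ m : ℕ) := by
  -- The sums at `1` and `-1` are the same integer, so their product is its square.
  have h := sum_addChar_mul_sum_addChar_neg hψ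
    (twistedTraceForm_nondegenerate (F := F) hF hp hn hm) (one_ne_zero (α := ZMod p))
  rw [sum_addChar_twistedTraceForm hF hψ hk one_ne_zero,
    sum_addChar_twistedTraceForm hF hψ hk (neg_ne_zero.2 one_ne_zero), hF] at h
  rw [sq]
  exact_mod_cast h

omit [Field F] [DecidableEq F] [Algebra (ZMod p) F] in
include hF hp in
theorem mul_pred_dvd_card_sub_one_of_even {s : ℕ} (hm : m = 2 * s) :
    2 * (p - 1) ∣ Fintype.card F - 1 := by
  have h1 : p ^ 2 - 1 ∣ Fintype.card F - 1 := by
    rw [hF, hm, pow_mul]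
    simpa using Nat.sub_dvd_pow_sub_pow (p ^ 2) 1 s
  refine Dvd.dvd.trans ?_ h1
  have h2 : p ^ 2 - 1 = (p + 1) * (p - 1) := by
    simpa using Nat.sq_sub_sq p 1
  rw [h2]
  exact Nat.mul_dvd_mul_right (((Fact.out : p.Prime).odd_of_ne_two hp).add_one).two_dvd _

omit [Fact p.Prime] [Field F] [DecidableEq F] [Algebra (ZMod p) F] in
include hF in
theorem mul_pred_dvd_card_sub_one {v k : ℕ} (hm : m = 2 * v * k) :
    (p ^ v + 1) * (p - 1) ∣ Fintype.card F - 1 := by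
  have h1 : (p ^ v) ^ 2 - 1 ∣ Fintype.card F - 1 := by
    rw [hF, hm, ← pow_mul, mul_comm v 2, pow_mul p (2 * v)]
    simpa using Nat.sub_dvd_pow_sub_pow (p ^ (2 * v)) 1 k
  refine Dvd.dvd.trans ?_ h1
  have h2 : (p ^ v) ^ 2 - 1 = (p ^ v + 1) * (p ^ v - 1) := by
    simpa using Nat.sq_sub_sq (p ^ v) 1
  rw [h2]
  refine Nat.mul_dvd_mul_left _ ?_
  simpa using Nat.sub_dvd_pow_sub_pow p 1 v

omit [DecidableEq F] in
include hF in
theorem exists_pow_succ_eq_algebraMap {v k n : ℕ} (hm : m = 2 * v * k) (hn : Odd n) {t : ZMod p}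
    (ht : t ≠ 0) : ∃ y : F, y ^ (p ^ (v * n) + 1) = algebraMap (ZMod p) F t := by
  classical
  obtain ⟨y, hy⟩ := exists_pow_eq_algebraMap (mul_pred_dvd_card_sub_one hF hm) ht
  refine ⟨y, ?_⟩
  have hy0 : y ≠ 0 := by
    rintro rfl
    rw [zero_pow (Nat.succ_ne_zero _)] at hy
    exact ht ((algebraMap (ZMod p) F).injective (by rw [← hy, map_zero]))
  -- The norm-like product `y * y ^ p ^ v` lies in the prime field, so it is fixed by `p ^ v`-th
  -- powers; cancelling `y ^ p ^ v` remains.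
  have h2 : y ^ p ^ (v + v) = y := by
    have h : (y ^ (p ^ v + 1)) ^ p ^ v = y ^ (p ^ v + 1) := by
      rw [hy, ← map_pow, ZMod.pow_card_pow]
    rw [← pow_mul, add_mul, one_mul, pow_add, ← pow_add p, pow_succ', mul_comm y] at h
    rw [mul_comm] at h
    exact mul_left_cancel₀ (pow_ne_zero _ hy0) h
  have h3 : y ^ p ^ (v * n) = y ^ p ^ v := by
    obtain ⟨j, rfl⟩ := hn
    induction j with
    | zero => simp
    | succ j ih =>
      have : v * (2 * (j + 1) + 1) = (v + v) + v * (2 * j + 1) := by ring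
      rw [this, pow_add, pow_mul, h2, ih]
  rw [pow_succ, h3, ← pow_succ, hy]

include hF hp hψ in
/-- The exponential sum of `Tr (y ^ (p ^ (v * n) + 1))` over a field of order `p ^ (2 * v * k)`
with `k` and `n` odd. -/
theorem sum_addChar_twistedTraceForm_eq_neg {v k n : ℕ} (hm : m = 2 * v * k) (hk : Odd k)
    (hn : Odd n) {c : ZMod p} (hc : c ≠ 0) :
    ∑ y : F, ψ (c * twistedTraceForm p F (v * n) y y) = -(p : ℂ) ^ (v * k) := by
  have hpp : p.Prime := Fact.out
  have hpow : ∀ t : ZMod p, t ≠ 0 → ∃ y : F, y ^ (p ^ (v * n) + 1) = algebraMap (ZMod p) F t :=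
    fun t ht => exists_pow_succ_eq_algebraMap hF hm hn ht
  have hsq := sq_sub_card_trace_eq hF hp hψ (u := v * n) hk ⟨n, by rw [hm]; ring⟩ hpow
  rw [sum_addChar_twistedTraceForm hF hψ hpow hc]
  -- As `n` is odd, `y ^ (p ^ v + 1) = 1` implies `y ^ (p ^ (v * n) + 1) = 1`, so `p ^ v + 1`
  -- divides the order of the kernel of the larger power.
  have hdvd : p ^ v + 1 ∣ (Finset.univ.filter fun y : F =>
      Algebra.trace (ZMod p) F (y ^ (p ^ (v * n) + 1)) = 1).card := by
    refine dvd_card_filter_comp_pow (F := F) _ _ (dvd_card_filter_pow_eq_one (Nat.succ_pos _)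
      (dvd_of_mul_right_dvd (mul_pred_dvd_card_sub_one hF hm)) fun y hy => ?_)
      (fun a => Algebra.trace (ZMod p) F a = 1) (by simp)
    rw [pow_succ] at hy
    have h0 : y ≠ 0 := by
      rintro rfl
      simp at hy
    rw [pow_succ, pow_prime_pow_odd_mul_eq_inv (eq_inv_of_mul_eq_one_left hy) hn,
      inv_mul_cancel₀ h0]
  generalize (Finset.univ.filter fun y : F =>
      Algebra.trace (ZMod p) F (y ^ (p ^ (v * n) + 1)) = 1).card = R at hsq hdvd ⊢
  have hq : ((p ^ m : ℕ) : ℤ) = ((p : ℤ) ^ (v * k)) ^ 2 := by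
    rw [hm]
    push_cast
    ring
  rw [hq] at hsq ⊢
  have h1 : ((p : ℤ) ^ v + 1) ∣ (p : ℤ) ^ (v * k) + 1 := by
    have := hk.add_dvd_pow_add_pow ((p : ℤ) ^ v) 1
    rwa [one_pow, ← pow_mul] at this
  have h2 : ((p : ℤ) ^ v + 1) ∣ R := by exact_mod_cast hdvd
  rcases sq_eq_sq_iff_eq_or_eq_neg.1 hsq with h | h
  · exfalso
    -- With `X = p ^ (v * k)`, the positive sign means `X² - pR = X`, that is `2 = (X + 1)(2 - X) +
    -- pR`, and `p ^ v + 1` divides both terms.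
    have h3 : ((p : ℤ) ^ v + 1) ∣ 2 := by
      obtain ⟨a, ha⟩ := h1
      obtain ⟨b, hb⟩ := h2
      refine ⟨a * (2 - p ^ (v * k)) + p * b, ?_⟩
      linear_combination h + (2 - (p : ℤ) ^ (v * k)) * ha + p * hb
    have hv : v ≠ 0 := by
      rintro rfl
      have := exponent_pos hF
      omega
    have h4 := Int.le_of_dvd (by norm_num) h3
    have h5 : (2 : ℤ) ≤ p := by exact_mod_cast hpp.two_le
    have h6 : (p : ℤ) ≤ p ^ v := le_self_pow₀ (by linarith) hv
    linarith
  · rw [h]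
    push_cast
    rfl

include hF hp in
-- The count is twice the number of squares of trace `1`, and that number is odd by two involutions:
-- `a ↦ a ^ p ^ s`, then `a ↦ 2 * a₀ - a` on its fixed points, which leaves only `a₀`.
theorem card_trace_sq_modEq {s : ℕ} (hm : m = 2 * s) :
    (Finset.univ.filter fun x : F => Algebra.trace (ZMod p) F (x ^ 2) = 1).card ≡ 2 [MOD 4] := by
  have hpp : p.Prime := Fact.out
  have hchar : CharP F p := (Algebra.charP_iff (ZMod p) F p).1 inferInstance
  have hF2 : ringChar F ≠ 2 := by rwa [ringChar.eq F p]
  have h2 : (2 : F) ≠ 0 := two_ne_zero_of_algebra (p := p) hp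
  have h2' : (2 : ZMod p) ≠ 0 := two_ne_zero_of_algebra (p := p) hp
  let A : Finset F := Finset.univ.filter fun a => IsSquare a ∧ Algebra.trace (ZMod p) F a = 1
  have hR : (Finset.univ.filter fun x : F => Algebra.trace (ZMod p) F (x ^ 2) = 1).card =
      2 * A.card := by
    rw [Finset.card_eq_sum_card_fiberwise (f := fun x : F => x ^ 2) (t := A), mul_comm,
      ← smul_eq_mul, ← Finset.sum_const]
    · refine Finset.sum_congr rfl fun a ha => ?_
      obtain ⟨ha1, ha2⟩ := (Finset.mem_filter.1 ha).2
      have ha0 : a ≠ 0 := by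
        rintro rfl
        simp at ha2
      have h := quadraticChar_card_sqrts hF2 a
      rw [Set.toFinset_ofPred, (quadraticChar_one_iff_isSquare ha0).2 ha1] at h
      rw [Finset.filter_filter]
      have : (Finset.univ.filter fun x : F => Algebra.trace (ZMod p) F (x ^ 2) = 1 ∧ x ^ 2 = a) =
          Finset.univ.filter fun x : F => x ^ 2 = a :=
        Finset.filter_congr fun x _ => ⟨fun h => h.2, fun h => ⟨h ▸ ha2, h⟩⟩
      rw [this]
      exact_mod_cast h
    · intro x hx
      have := (Finset.mem_filter.1 hx).2
      exact Finset.mem_filter.2 ⟨Finset.mem_univ _, ⟨x, sq x⟩, this⟩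
  have hfrob : ∀ a : F, (a ^ p ^ s) ^ p ^ s = a := by
    intro a
    rw [← pow_mul, ← pow_add]
    exact pow_prime_pow_eq_self hF ⟨1, by omega⟩ a
  have hA := card_modEq_card_fixed_of_involutive_on A (fun a => a ^ p ^ s)
    (fun a ha => by
      obtain ⟨ha1, ha2⟩ := (Finset.mem_filter.1 ha).2
      exact Finset.mem_filter.2 ⟨Finset.mem_univ _, ha1.pow _, by rw [trace_pow_prime_pow, ha2]⟩)
    (fun a _ => hfrob a)
  obtain ⟨z, hz⟩ := exists_trace_eq (F := F) (2⁻¹ : ZMod p)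
  obtain ⟨a₀, ha₀, ha₀'⟩ : ∃ a : F, a ^ p ^ s = a ∧ Algebra.trace (ZMod p) F a = 1 := by
    refine ⟨z + z ^ p ^ s, ?_, ?_⟩
    · rw [add_pow_char_pow, hfrob, add_comm]
    · rw [map_add, trace_pow_prime_pow, hz, ← two_mul, mul_inv_cancel₀ h2']
  -- Every element of the subfield of order `p ^ s` is a square: `(p ^ (2 * s) - 1) / 2` is a
  -- multiple of `p ^ s - 1`, and Euler's criterion applies.
  have hsquare : ∀ a : F, a ^ p ^ s = a → IsSquare a := by
    intro a ha
    by_cases ha0 : a = 0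
    · simp [ha0]
    rw [FiniteField.isSquare_iff hF2 ha0]
    obtain ⟨j, hj⟩ := ((hpp.odd_of_ne_two hp).pow (n := s))
    have hcard : Fintype.card F / 2 = (p ^ s - 1) * (j + 1) := by
      rw [hF, hm, mul_comm 2 s, pow_mul, hj]
      have : (2 * j + 1) ^ 2 = 2 * (2 * j * (j + 1)) + 1 := by ring
      rw [this]
      simp only [Nat.add_sub_cancel]
      omega
    have h1 : a ^ (p ^ s - 1) = 1 := by
      have h := ha
      rw [← Nat.sub_add_cancel (Nat.pow_pos hpp.pos (n := s)), pow_succ] at h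
      exact mul_right_cancel₀ ha0 (by rw [h, one_mul])
    rw [hcard, pow_mul, h1, one_pow]
  have hfix := card_modEq_card_fixed_of_involutive_on (A.filter fun a => a ^ p ^ s = a)
    (fun a => 2 * a₀ - a)
    (fun a ha => by
      obtain ⟨ha1, ha2⟩ := Finset.mem_filter.1 ha
      have ha3 := (Finset.mem_filter.1 ha1).2.2
      have h1 : (2 * a₀ - a) ^ p ^ s = 2 * a₀ - a := by
        rw [sub_pow_char_pow, two_mul, add_pow_char_pow, ha₀, ha2]
      refine Finset.mem_filter.2 ⟨Finset.mem_filter.2 ⟨Finset.mem_univ _, hsquare _ h1, ?_⟩, h1⟩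
      rw [two_mul, map_sub, map_add, ha₀', ha3]
      ring)
    (fun a _ => by ring)
  have hone : ((A.filter fun a => a ^ p ^ s = a).filter fun a => 2 * a₀ - a = a) = {a₀} := by
    ext a
    simp only [Finset.mem_filter, Finset.mem_singleton, A, Finset.mem_univ, true_and]
    constructor
    · rintro ⟨-, h⟩
      exact mul_left_cancel₀ h2 (by linear_combination -h)
    · rintro rfl
      exact ⟨⟨⟨hsquare a ha₀, ha₀'⟩, ha₀⟩, by ring⟩
  rw [hone, Finset.card_singleton] at hfix
  have hodd := hA.trans hfix
  rw [hR]
  unfold Nat.ModEq at *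
  omega

include hF hp hψ in
/-- The quadratic Gauss sum over a field of order `p ^ (2 * s)`. -/
theorem exists_sum_addChar_twistedTraceForm_zero {s : ℕ} (hm : m = 2 * s) :
    ∃ ε : ℤ, (ε = 1 ∨ ε = -1) ∧ ε * p ^ s ≡ 1 [ZMOD 4] ∧ ∀ c : ZMod p, c ≠ 0 →
      ∑ y : F, ψ (c * twistedTraceForm p F 0 y y) = -((ε : ℂ) * p ^ s) := by
  have hpow : ∀ t : ZMod p, t ≠ 0 → ∃ y : F, y ^ (p ^ 0 + 1) = algebraMap (ZMod p) F t :=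
    fun t ht => exists_pow_eq_algebraMap (mul_pred_dvd_card_sub_one_of_even hF hp hm) ht
  have hsq := sq_sub_card_trace_eq hF hp hψ (u := 0) (n := 1) odd_one (by simp) hpow
  have hsum := fun (c : ZMod p) (hc : c ≠ 0) => sum_addChar_twistedTraceForm hF hψ hpow hc
  have hmod : (Finset.univ.filter fun x : F =>
      Algebra.trace (ZMod p) F (x ^ (p ^ 0 + 1)) = 1).card ≡ 2 [MOD 4] := by
    simpa only [pow_zero, one_add_one_eq_two] using card_trace_sq_modEq hF hp hm
  generalize (Finset.univ.filter fun x : F =>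
    Algebra.trace (ZMod p) F (x ^ (p ^ 0 + 1)) = 1).card = R at hsq hsum hmod
  obtain ⟨b, hb⟩ := (Fact.out : p.Prime).odd_of_ne_two hp
  have hq : ((p ^ m : ℕ) : ℤ) = ((p : ℤ) ^ s) ^ 2 := by
    rw [hm]
    push_cast
    ring
  -- Modulo `4`, an odd square is `1` and `p * R` is `2`.
  have hS : ((p ^ m : ℕ) - p * R : ℤ) ≡ -1 [ZMOD 4] := by
    rw [hq]
    obtain ⟨a, ha⟩ : Odd ((p : ℤ) ^ s) := by
      refine Odd.pow ?_
      exact_mod_cast (Fact.out : p.Prime).odd_of_ne_two hp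
    obtain ⟨r, rfl⟩ : ∃ r, R = 4 * r + 2 := ⟨R / 4, by unfold Nat.ModEq at hmod; omega⟩
    have hb' : (p : ℤ) = 2 * b + 1 := by exact_mod_cast hb
    rw [ha, hb']
    refine Int.modEq_iff_dvd.2 ⟨-(a ^ 2 + a) + 2 * b * r + b + r, ?_⟩
    push_cast
    ring
  rw [hq] at hsq
  rcases sq_eq_sq_iff_eq_or_eq_neg.1 hsq with h | h
  · refine ⟨-1, Or.inr rfl, ?_, fun c hc => ?_⟩
    · rw [hq, h] at hS
      simpa using hS.neg
    · rw [hsum c hc, hq, h]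
      push_cast
      ring
  · refine ⟨1, Or.inl rfl, ?_, fun c hc => ?_⟩
    · rw [hq, h] at hS
      simpa using hS.neg
    · rw [hsum c hc, hq, h]
      push_cast
      ring

end EvenQuotient

/-! ### The quadratic form on the plane and its code -/

section DirectSum

variable (p u : ℕ) [Fact p.Prime] (F : Type*) [Field F] [Algebra (ZMod p) F]

/-- The bilinear form `((x, y), (x', y')) ↦ Tr (x * x' + y * y' ^ (p ^ u))`. -/
noncomputable def planeForm : LinearMap.BilinForm (ZMod p) (F × F) :=
  (twistedTraceForm p F 0).compl₁₂ (LinearMap.fst _ F F) (LinearMap.fst _ F F) +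
    (twistedTraceForm p F u).compl₁₂ (LinearMap.snd _ F F) (LinearMap.snd _ F F)

variable {p u F}

theorem planeForm_apply (z w : F × F) :
    planeForm p u F z w = twistedTraceForm p F 0 z.1 w.1 + twistedTraceForm p F u z.2 w.2 := rfl

/-- At `u = 0` the form is the trace pairing defining the codewords, so one construction covers both
parametrizations of the dual space. -/
theorem planeForm_zero_apply (a z : F × F) :
    planeForm p 0 F a z = Algebra.trace (ZMod p) F (a.1 * z.1 + a.2 * z.2) := by
  simp [planeForm_apply, twistedTraceForm_apply]

variable [Fintype F]

theorem sum_addChar_planeForm (ψ : AddChar (ZMod p) ℂ) (c : ZMod p) :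
    ∑ z, ψ (c * planeForm p u F z z) =
      (∑ x, ψ (c * twistedTraceForm p F 0 x x)) * ∑ y, ψ (c * twistedTraceForm p F u y y) := by
  rw [Fintype.sum_prod_type, Finset.sum_mul_sum]
  simp_rw [planeForm_apply, mul_add, AddChar.map_add_eq_mul]

theorem planeForm_nondegenerate {m n : ℕ} (hF : Fintype.card F = p ^ m) (hp : p ≠ 2)
    (hn : Odd n) (hm : m ∣ 2 * u * n) (w : F × F)
    (h : ∀ z, planeForm p u F z w + planeForm p u F w z = 0) : w = 0 := by
  refine Prod.ext ?_ ?_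
  · refine twistedTraceForm_nondegenerate (p := p) hF hp (u := 0) (n := 1) odd_one (by simp) _
      fun x => ?_
    simpa [planeForm_apply] using h (x, 0)
  · refine twistedTraceForm_nondegenerate (p := p) hF hp hn hm _ fun y => ?_
    simpa [planeForm_apply] using h (0, y)

theorem planeForm_zero_injective : Function.Injective (planeForm p 0 F) := by
  rw [injective_iff_map_eq_zero]
  intro a ha
  refine Prod.ext ?_ ?_
  · refine eq_zero_of_trace_mul_eq_zero (p := p) fun x => ?_
    simpa [planeForm_zero_apply] using LinearMap.congr_fun ha (x, 0)
  · refine eq_zero_of_trace_mul_eq_zero (p := p) fun y => ?_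
    simpa [planeForm_zero_apply] using LinearMap.congr_fun ha (0, y)

theorem definingSetCode_eq_range_polarCodeword
    (hB : ∀ w, (∀ z, planeForm p u F z w + planeForm p u F w z = 0) → w = 0)
    (D : Finset (F × F)) :
    definingSetCode p D = LinearMap.range (polarCodeword (planeForm p u F) D) := by
  let f : F × F →ₗ[ZMod p] Module.Dual (ZMod p) (F × F) :=
    (planeForm p u F).flip + planeForm p u F
  let g : F × F →ₗ[ZMod p] Module.Dual (ZMod p) (F × F) := planeForm p 0 F
  have hfr : Module.finrank (ZMod p) (F × F) =
      Module.finrank (ZMod p) (Module.Dual (ZMod p) (F × F)) := Subspace.dual_finrank_eq.symm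
  have hf : Function.Surjective f := by
    rw [← LinearMap.injective_iff_surjective_of_finrank_eq_finrank hfr, injective_iff_map_eq_zero]
    exact fun w hw => hB w fun z => LinearMap.congr_fun hw z
  have hg : Function.Surjective g :=
    (LinearMap.injective_iff_surjective_of_finrank_eq_finrank hfr).1 planeForm_zero_injective
  ext c
  constructor
  · rintro ⟨a, rfl⟩
    obtain ⟨w, hw⟩ := hf (g a)
    refine ⟨w, funext fun d => ?_⟩
    have := LinearMap.congr_fun hw d.1
    exact this.trans (planeForm_zero_apply a d.1)
  · rintro ⟨w, rfl⟩
    obtain ⟨a, ha⟩ := hg (f w)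
    refine ⟨a, funext fun d => ?_⟩
    have := LinearMap.congr_fun ha d.1
    exact (planeForm_zero_apply a d.1).symm.trans this

theorem definingSetTwo_eq_isotropicSet [DecidableEq F] :
    definingSetTwo p u F = isotropicSet (planeForm p u F) := by
  ext z
  simp only [definingSetTwo, isotropicSet, Finset.mem_filter, Finset.mem_univ, true_and,
    planeForm_apply, twistedTraceForm_self, ← map_add, pow_zero, one_add_one_eq_two]
  rfl

end DirectSum

/-! ### The sign of the exponential sum -/

section Sign

theorem pow_mod_four_eq_three_iff {p : ℕ} (hp : Odd p) (m : ℕ) :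
    p ^ m % 4 = 3 ↔ p % 4 = 3 ∧ Odd m := by
  have h4 : p % 4 = 1 ∨ p % 4 = 3 := by
    have := Nat.odd_iff.1 hp
    omega
  rcases h4 with h | h
  · simp [Nat.pow_mod, h]
  · rcases Nat.even_or_odd' m with ⟨k, rfl | rfl⟩
    · have : p ^ (2 * k) % 4 = 1 := by
        rw [pow_mul, Nat.pow_mod, Nat.pow_mod p, h]
        simp
      rw [this]
      simp
    · have : p ^ (2 * k + 1) % 4 = 3 := by
        rw [pow_succ, pow_mul, Nat.mul_mod, Nat.pow_mod, Nat.pow_mod p, h]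
        simp
      simp [this, h]

theorem sign_eq_neg_one_iff_of_mul_modEq {ε : ℤ} (hε : ε = 1 ∨ ε = -1) {a : ℕ}
    (h : ε * a ≡ 1 [ZMOD 4]) : ε = -1 ↔ a % 4 = 3 := by
  unfold Int.ModEq at h
  rcases hε with rfl | rfl <;> omega

variable {p u m : ℕ} [Fact p.Prime] {F : Type*} [Field F] [Fintype F] [Algebra (ZMod p) F]

/-- Both factors are the same quadratic Gauss sum, so `ε` is the value of `χ₄` at `p ^ m`, and `m`
has the parity of `v`. -/
theorem exists_sum_addChar_planeForm_of_odd (hF : Fintype.card F = p ^ m) (hp : p ≠ 2)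
    {ψ : AddChar (ZMod p) ℂ} (hψ : ψ.IsPrimitive) {v n : ℕ} (hn : Odd n) (hm : m = v * n)
    (hv : v ∣ u) :
    ∃ ε : ℤ, (ε = 1 ∨ ε = -1) ∧ (ε = -1 ↔ p % 4 = 3 ∧ Odd v) ∧
      ∀ c : ZMod p, c ≠ 0 → ∑ z, ψ (c * planeForm p u F z z) = ε * (p : ℂ) ^ m := by
  classical
  have hodd : Odd p := (Fact.out : p.Prime).odd_of_ne_two hp
  have hmu : m ∣ u * n := by
    obtain ⟨j, rfl⟩ := hv
    exact ⟨j, by rw [hm]; ring⟩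
  have hmv : Odd m ↔ Odd v := by simp [hm, Nat.odd_mul, hn]
  refine ⟨ZMod.χ₄ (p ^ m : ℕ), ?_, ?_, fun c hc => ?_⟩
  · have : p ^ m % 4 = 1 ∨ p ^ m % 4 = 3 := by
      have := Nat.odd_iff.1 (hodd.pow (n := m))
      omega
    exact this.imp ZMod.χ₄_nat_one_mod_four ZMod.χ₄_nat_three_mod_four
  · rw [← hmv, ← pow_mod_four_eq_three_iff hodd]
    constructor
    · intro h
      by_contra h3
      have h1 : p ^ m % 4 = 1 := by
        have := Nat.odd_iff.1 (hodd.pow (n := m))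
        omega
      rw [ZMod.χ₄_nat_one_mod_four h1] at h
      norm_num at h
    · exact ZMod.χ₄_nat_three_mod_four
  · have h0 := sum_addChar_pow_succ_eq_sum_sq hp hF hn hmu
      fun x : F => ψ (c * Algebra.trace (ZMod p) F x)
    rw [sum_addChar_planeForm]
    simp_rw [twistedTraceForm_self, pow_zero, one_add_one_eq_two]
    rw [h0, ← sq, sum_addChar_trace_sq_sq hF hp hψ hc]
    push_cast
    rfl

/-- The factors are `-(ε p ^ (v * k))` and `-p ^ (v * k)`, where `ε p ^ (v * k) ≡ 1` modulo `4`. -/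
theorem exists_sum_addChar_planeForm_of_two_mul_odd (hF : Fintype.card F = p ^ m) (hp : p ≠ 2)
    {ψ : AddChar (ZMod p) ℂ} (hψ : ψ.IsPrimitive) {v k n : ℕ} (hk : Odd k) (hn : Odd n)
    (hm : m = 2 * v * k) (hu : u = v * n) :
    ∃ ε : ℤ, (ε = 1 ∨ ε = -1) ∧ (ε = -1 ↔ p % 4 = 3 ∧ Odd v) ∧
      ∀ c : ZMod p, c ≠ 0 → ∑ z, ψ (c * planeForm p u F z z) = ε * (p : ℂ) ^ m := by
  classical
  have hodd : Odd p := (Fact.out : p.Prime).odd_of_ne_two hp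
  obtain ⟨ε, hε, hmod, hsum⟩ :=
    exists_sum_addChar_twistedTraceForm_zero (s := v * k) hF hp hψ (by rw [hm]; ring)
  refine ⟨ε, hε, ?_, fun c hc => ?_⟩
  · have := sign_eq_neg_one_iff_of_mul_modEq hε (a := p ^ (v * k)) (by exact_mod_cast hmod)
    rw [this, pow_mod_four_eq_three_iff hodd, Nat.odd_mul, and_iff_left hk]
  · rw [sum_addChar_planeForm, hsum c hc, hu,
      sum_addChar_twistedTraceForm_eq_neg hF hp hψ hm hk hn hc, hm]
    ring

end Sign

/-! ### The weight distribution -/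

theorem theorem5 (p m u : ℕ) [Fact p.Prime] (hp : p ≠ 2) (hu : 0 < u)
    (F : Type*) [Field F] [Fintype F] [DecidableEq F] [Algebra (ZMod p) F]
    (hF : Fintype.card F = p ^ m)
    (hmv : Odd (m / Nat.gcd m u) ∨ m / Nat.gcd m u ≡ 2 [MOD 4])
    (hne : ¬ (p ≡ 3 [MOD 4] ∧ m = 1)) :
    IsWeightCode 2 (definingSetCode p (definingSetTwo p u F)) ∧
    ((p ≡ 3 [MOD 4] ∧ Odd (Nat.gcd m u)) →
      IsLinearCode (definingSetCode p (definingSetTwo p u F))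
        ((p ^ m + 1) * (p ^ (m - 1) - 1)) (2 * m) ∧
      ∀ w : ℕ, (weightCount (definingSetCode p (definingSetTwo p u F)) w : ℚ) =
        if w = 0 then 1
        else if (w : ℚ) = ((p : ℚ) - 1) * (p : ℚ) ^ (2 * m - 2) then
          ((p : ℚ) ^ m + 1) * ((p : ℚ) ^ (m - 1) - 1)
        else if (w : ℚ) = ((p : ℚ) - 1) * (p : ℚ) ^ (2 * m - 2) * (1 - 1 / (p : ℚ) ^ (m - 1)) then
          ((p : ℚ) ^ m + 1) * (p : ℚ) ^ (m - 1) * ((p : ℚ) - 1)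
        else 0) ∧
    (¬ (p ≡ 3 [MOD 4] ∧ Odd (Nat.gcd m u)) →
      IsLinearCode (definingSetCode p (definingSetTwo p u F))
        ((p ^ m - 1) * (p ^ (m - 1) + 1)) (2 * m) ∧
      ∀ w : ℕ, (weightCount (definingSetCode p (definingSetTwo p u F)) w : ℚ) =
        if w = 0 then 1
        else if (w : ℚ) = ((p : ℚ) - 1) * (p : ℚ) ^ (2 * m - 2) then
          ((p : ℚ) ^ m - 1) * ((p : ℚ) ^ (m - 1) + 1)
        else if (w : ℚ) = ((p : ℚ) - 1) * (p : ℚ) ^ (2 * m - 2) * (1 + 1 / (p : ℚ) ^ (m - 1)) then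
          ((p : ℚ) ^ m - 1) * (p : ℚ) ^ (m - 1) * ((p : ℚ) - 1)
        else 0) := by
  have hpp : p.Prime := Fact.out
  have hm0 : 0 < m := exponent_pos hF
  have hψ : (ZMod.stdAddChar (N := p)).IsPrimitive := ZMod.isPrimitive_stdAddChar p
  obtain ⟨v, hv⟩ : ∃ v, v = Nat.gcd m u := ⟨_, rfl⟩
  have hvpos : 0 < v := hv ▸ Nat.gcd_pos_of_pos_right m hu
  have hvm : v ∣ m := hv ▸ Nat.gcd_dvd_left m u
  have hvu : v ∣ u := hv ▸ Nat.gcd_dvd_right m u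
  have hmdiv : m = v * (m / v) := (Nat.mul_div_cancel' hvm).symm
  have hudiv : u = v * (u / v) := (Nat.mul_div_cancel' hvu).symm
  obtain ⟨⟨n, hn, hmn⟩, ε, hε, hsign, hS⟩ : (∃ n, Odd n ∧ m ∣ 2 * u * n) ∧
      ∃ ε : ℤ, (ε = 1 ∨ ε = -1) ∧ (ε = -1 ↔ p % 4 = 3 ∧ Odd v) ∧ ∀ c : ZMod p, c ≠ 0 →
        ∑ z, ZMod.stdAddChar (N := p) (c * planeForm p u F z z) = ε * (p : ℂ) ^ m := by
    rw [← hv] at hmv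
    rcases hmv with h | h
    · refine ⟨⟨m / v, h, 2 * (u / v), ?_⟩, exists_sum_addChar_planeForm_of_odd hF hp hψ h hmdiv hvu⟩
      nth_rw 1 [hudiv]
      nth_rw 2 [hmdiv]
      ring
    · obtain ⟨k, hk⟩ : ∃ k, m / v = 2 * k := ⟨m / v / 2, by unfold Nat.ModEq at h; omega⟩
      have hkodd : Odd k := by
        rw [Nat.odd_iff]
        unfold Nat.ModEq at h
        omega
      have hm2 : m = 2 * v * k := by
        rw [hmdiv, hk]
        ring
      have hcop : Nat.Coprime (m / v) (u / v) := by
        rw [hv]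
        exact Nat.coprime_div_gcd_div_gcd (hv ▸ hvpos)
      -- `u / v` is coprime to the even number `m / v`.
      have huodd : Odd (u / v) := by
        rw [hk] at hcop
        exact Nat.coprime_two_left.1 (Nat.Coprime.coprime_mul_right hcop)
      refine ⟨⟨k, hkodd, u / v, ?_⟩,
        exists_sum_addChar_planeForm_of_two_mul_odd hF hp hψ hkodd huodd hm2 hudiv⟩
      nth_rw 1 [hudiv]
      rw [hm2]
      ring
  have hB := planeForm_nondegenerate (u := u) hF hp hn hmn
  obtain ⟨r, hr⟩ : ∃ r, r = p ^ (m - 1) := ⟨_, rfl⟩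
  have hpr : p ^ m = p * r := by rw [hr, ← pow_succ', Nat.sub_add_cancel hm0]
  have hrr : p ^ (2 * m - 2) = r ^ 2 := by
    rw [hr, ← pow_mul]
    congr 1
    omega
  have hr0 : 0 < r := hr ▸ Nat.pow_pos hpp.pos
  have hpos : 0 < (r : ℤ) + ε := by
    rcases hε with h | h
    · rw [h]
      positivity
    · have hp3 := (hsign.1 h).1
      have hm1 : m ≠ 1 := fun h1 => hne ⟨hp3, h1⟩
      have : 1 < r := hr ▸ Nat.one_lt_pow (by omega) hpp.one_lt
      omega
  have hV : Fintype.card (F × F) = (Fintype.card (ZMod p) * r) ^ 2 := by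
    rw [Fintype.card_prod, hF, hpr, ZMod.card, sq]
  have hS' : ∀ c : ZMod p, c ≠ 0 → ∑ z, ZMod.stdAddChar (N := p) (c * planeForm p u F z z) =
      ε * (Fintype.card (ZMod p) * r) := by
    intro c hc
    rw [hS c hc, ZMod.card]
    exact_mod_cast congrArg (fun x : ℕ => (ε : ℂ) * x) hpr
  have hcode := definingSetCode_eq_range_polarCodeword hB (definingSetTwo p u F)
  rw [hcode, definingSetTwo_eq_isotropicSet]
  have hε0 : ε ≠ 0 := by rcases hε with rfl | rfl <;> decide
  have hweight := weightCount_polarCode hψ hV hS' hB hr0 hε0 hpos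
  have hcard : ((isotropicSet (planeForm p u F)).card : ℤ) =
      p * r ^ 2 + (p - 1) * (ε * r) - 1 := by
    rw [card_isotropicSet, card_isotropic hψ hV hS', ZMod.card]
  have hrank : Module.finrank (ZMod p) (LinearMap.range (polarCodeword (planeForm p u F)
      (isotropicSet (planeForm p u F)))) = 2 * m := by
    rw [LinearMap.finrank_range_of_inj (polarCodeword_injective hψ hV hS' hB hr0 hpos),
      Module.finrank_prod]
    have h := Module.card_eq_pow_finrank (K := ZMod p) (V := F)
    rw [hF, ZMod.card] at h
    rw [← Nat.pow_right_injective hpp.two_le h]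
    ring
  have hsign' : ε = -1 ↔ p ≡ 3 [MOD 4] ∧ Odd (Nat.gcd m u) := by
    rw [hsign, hv]
    rfl
  have hpQ : (p : ℚ) ^ m = p * r := by exact_mod_cast hpr
  have hrQ : (p : ℚ) ^ (m - 1) = r := by exact_mod_cast hr.symm
  have hrrQ : (p : ℚ) ^ (2 * m - 2) = r ^ 2 := by exact_mod_cast hrr
  have hr0Q : (r : ℚ) ≠ 0 := by exact_mod_cast hr0.ne'
  have hiff1 : ∀ w : ℕ, (w : ℚ) = (p - 1) * r ^ 2 ↔ (w : ℤ) = (p - 1) * r ^ 2 := fun w => by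
    norm_cast
  have hiff2 : ∀ (w : ℕ) (e : ℤ), (w : ℚ) = (p - 1) * r ^ 2 * (1 + e / r) ↔
      (w : ℤ) = (p - 1) * (r ^ 2 + e * r) := fun w e => by
    have : ((p : ℚ) - 1) * r ^ 2 * (1 + e / r) = (p - 1) * (r ^ 2 + e * r) := by
      field_simp
    rw [this]
    norm_cast
  refine ⟨isWeightCode_two_polarCode hψ hV hS' hB hr0 hε hpos, fun h => ?_, fun h => ?_⟩
  · obtain rfl : ε = -1 := hsign'.2 h
    refine ⟨⟨?_, hrank⟩, fun w => ?_⟩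
    · rw [Fintype.card_coe, hpr, ← hr]
      zify [hr0]
      rw [hcard]
      ring
    · have hw : (weightCount (LinearMap.range (polarCodeword (planeForm p u F)
        (isotropicSet (planeForm p u F)))) w : ℚ) = _ := congrArg (Int.cast : ℤ → ℚ) (hweight w)
      have h1 := hiff2 w (-1)
      rw [Int.cast_neg, Int.cast_one, neg_div, ← sub_eq_add_neg] at h1
      rw [hw, hpQ, hrQ, hrrQ, ZMod.card]
      simp only [hiff1, h1]
      split_ifs <;> push_cast <;> ring
  · obtain rfl : ε = 1 := hε.resolve_right fun h' => h (hsign'.1 h')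
    refine ⟨⟨?_, hrank⟩, fun w => ?_⟩
    · rw [Fintype.card_coe, hpr, ← hr]
      zify [Nat.mul_pos hpp.pos hr0]
      rw [hcard]
      ring
    · have hw : (weightCount (LinearMap.range (polarCodeword (planeForm p u F)
        (isotropicSet (planeForm p u F)))) w : ℚ) = _ := congrArg (Int.cast : ℤ → ℚ) (hweight w)
      have h1 := hiff2 w 1
      rw [Int.cast_one] at h1
      rw [hw, hpQ, hrQ, hrrQ, ZMod.card]
      simp only [hiff1, h1]
      split_ifs <;> push_cast <;> ring
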